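/- Let $1\le n\le 3$, let $\Omega\subset\mathbb R^n$ be a bounded Lipschitz domain, let $T,\alpha,\beta>0$, let $c:\mathbb R\to[0,\infty)$ be continuous and let $d:\mathbb R\to\mathbb R$ be continuously differentiable. Let $S\in C^{1,2}([0,T]\times\overline\Omega)$, i.e. $S$ is continuous on $[0,T]\times\overline\Omega$, and $\partial_tS$, $\nabla S$, $\nabla^2S$ exist on $[0,T]\times\Omega$ (with $\partial_t$ one-sided at $t=0,T$) and extend continuously to $[0,T]\times\overline\Omega$. Assume that $S$ satisfies pointwise $$c(|\nabla S|)\,\partial_tS=\operatorname{div}(\alpha\nabla S)-\beta d'(S)\quad\text{in }\Omega,\qquad \alpha\,\partial_{\nu}S=0\quad\text{on }\partial\Omega,\qquad 0<t\le T,$$ the boundary condition being imposed at all boundary points at which the outer unit normal $\nu$ exists. Set $$E(S(t))=\int_\Omega \frac{\alpha}{2}|\nabla S(t)|^2+\beta\, d(S(t))\,dx .$$ Then, for every $t\in[0,T]$, the integrals below and the one defining $E(S(t))$ converge absolutely, $s\mapsto E(S(s))$ is differentiable at $t$ (one-sidedly if $t\in\{0,T\}$), and $$\frac{d}{dt}E(S(t))=-\int_\Omega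 c(|\nabla S(t)|)\,|\partial_tS(t)|^2\,dx\le 0 .$$ -/

import Mathlib

open Set Filter Topology MeasureTheory
open scoped NNReal Gradient RealInnerProductSpace

noncomputable section

/-- Bounded Lipschitz domain in `ℝⁿ`: a bounded, open, connected, nonempty set which near each
boundary point is, in a suitable direction `e`, the strict epigraph of a Lipschitz function of the
component `y - ⟪e, y⟫ e` orthogonal to `e`. (Only the restriction of `g` to the hyperplane
orthogonal to `e` matters.) -/
structure IsBoundedLipschitzDomain {n : ℕ} (Ω : Set (EuclideanSpace ℝ (Fin n))) : Prop where
  isOpen : IsOpen Ω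
  isConnected : IsConnected Ω
  isBounded : Bornology.IsBounded Ω
  local_graph : ∀ x₀ ∈ frontier Ω, ∃ (e : EuclideanSpace ℝ (Fin n))
    (g : EuclideanSpace ℝ (Fin n) → ℝ) (K : ℝ≥0) (r : ℝ),
      ‖e‖ = 1 ∧ LipschitzWith K g ∧ 0 < r ∧
        ∀ y ∈ Metric.ball x₀ r, (y ∈ Ω ↔ g (y - ⟪e, y⟫ • e) < ⟪e, y⟫)

/-- `ν` is the outer unit normal to `Ω` at the boundary point `x`: to first order at `x`, the set
`Ω` is the half space `{y | ⟪y - x, ν⟫ < 0}`. On a Lipschitz domain such a `ν` exists at almost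
every boundary point, namely where the local graph function is differentiable. -/
def IsOuterUnitNormal {n : ℕ} (Ω : Set (EuclideanSpace ℝ (Fin n)))
    (x ν : EuclideanSpace ℝ (Fin n)) : Prop :=
  x ∈ frontier Ω ∧ ‖ν‖ = 1 ∧ ∀ ε : ℝ, 0 < ε → ∀ᶠ y in 𝓝 x,
    (⟪y - x, ν⟫ < -(ε * ‖y - x‖) → y ∈ Ω) ∧ (ε * ‖y - x‖ < ⟪y - x, ν⟫ → y ∉ Ω)

/-- The function `F`, given on `[0,T] × Ω`, has a continuous extension to `[0,T] × closure Ω`. -/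
def ExtendsContinuously {n : ℕ} {X : Type*} [TopologicalSpace X]
    (Ω : Set (EuclideanSpace ℝ (Fin n))) (T : ℝ) (F : ℝ → EuclideanSpace ℝ (Fin n) → X) : Prop :=
  ∃ G : ℝ → EuclideanSpace ℝ (Fin n) → X,
    ContinuousOn (fun p : ℝ × EuclideanSpace ℝ (Fin n) => G p.1 p.2) (Icc 0 T ×ˢ closure Ω) ∧
      ∀ t ∈ Icc 0 T, ∀ x ∈ Ω, G t x = F t x

/-- The time derivative `∂ₜS(t,x)` on `[0,T]`, one-sided at the end points. -/
def timeDeriv {n : ℕ} (T : ℝ) (S : ℝ → EuclideanSpace ℝ (Fin n) → ℝ) (t : ℝ)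
    (x : EuclideanSpace ℝ (Fin n)) : ℝ :=
  derivWithin (fun s => S s x) (Icc 0 T) t

/-- The class `C^{1,2}([0,T] × closure Ω)`: continuous functions, continuously differentiable in
`t` and twice continuously differentiable in `x`, whose derivatives `∂ₜS`, `∇S`, `∇²S` extend
continuously to `[0,T] × closure Ω`. -/
structure IsC12 {n : ℕ} (Ω : Set (EuclideanSpace ℝ (Fin n))) (T : ℝ)
    (S : ℝ → EuclideanSpace ℝ (Fin n) → ℝ) : Prop where
  continuousOn : ContinuousOn (fun p : ℝ × EuclideanSpace ℝ (Fin n) => S p.1 p.2)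
    (Icc 0 T ×ˢ closure Ω)
  differentiable_time : ∀ x ∈ Ω, DifferentiableOn ℝ (fun s => S s x) (Icc 0 T)
  contDiffOn_space : ∀ t ∈ Icc 0 T, ContDiffOn ℝ 2 (S t) Ω
  timeDeriv_extends : ExtendsContinuously Ω T (timeDeriv T S)
  gradient_extends : ExtendsContinuously Ω T (fun t => ∇ (S t))
  hessian_extends : ExtendsContinuously Ω T (fun t => fderiv ℝ (∇ (S t)))

/-- Divergence `∑ᵢ ∂ᵢ Fᵢ` of a vector field. -/
def divergence {n : ℕ} (F : EuclideanSpace ℝ (Fin n) → EuclideanSpace ℝ (Fin n))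
    (x : EuclideanSpace ℝ (Fin n)) : ℝ :=
  ∑ i : Fin n, fderiv ℝ (fun y => F y i) x (EuclideanSpace.single i 1)

/-- Derivative of `u` at a boundary point `x` of `Ω` in direction `ν`, through the continuous
extension of `∇u` from `Ω` to `x`. -/
def boundaryDeriv {n : ℕ} (Ω : Set (EuclideanSpace ℝ (Fin n)))
    (u : EuclideanSpace ℝ (Fin n) → ℝ) (x ν : EuclideanSpace ℝ (Fin n)) : ℝ :=
  ⟪extendFrom Ω (∇ u) x, ν⟫

/-- Smooth (classical `C^{1,2}`) solutions on `[0,T]` of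
`c(|∇S|) ∂ₜS = div (α ∇S) - β d'(S)` in `Ω`, `α ∂ₙS = 0` on `∂Ω`, for `t > 0`. The boundary
condition is imposed at all boundary points at which the outer unit normal exists. -/
structure IsSmoothSolution {n : ℕ} (Ω : Set (EuclideanSpace ℝ (Fin n))) (T α β : ℝ)
    (c d : ℝ → ℝ) (S : ℝ → EuclideanSpace ℝ (Fin n) → ℝ) : Prop where
  isC12 : IsC12 Ω T S
  equation : ∀ t ∈ Ioc 0 T, ∀ x ∈ Ω,
    c ‖∇ (S t) x‖ * timeDeriv T S t x =
      divergence (fun y => α • ∇ (S t) y) x - β * deriv d (S t x)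
  neumann : ∀ t ∈ Ioc 0 T, ∀ x ν, IsOuterUnitNormal Ω x ν → α * boundaryDeriv Ω (S t) x ν = 0

/-- The energy density `α/2 |∇u|² + β d(u)`. -/
def energyDensity {n : ℕ} (α β : ℝ) (d : ℝ → ℝ) (u : EuclideanSpace ℝ (Fin n) → ℝ)
    (x : EuclideanSpace ℝ (Fin n)) : ℝ :=
  α / 2 * ‖∇ u x‖ ^ 2 + β * d (u x)

/-- The energy `E(u) = ∫_Ω α/2 |∇u|² + β d(u) dx`. -/
def energy {n : ℕ} (Ω : Set (EuclideanSpace ℝ (Fin n))) (α β : ℝ) (d : ℝ → ℝ)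
    (u : EuclideanSpace ℝ (Fin n) → ℝ) : ℝ :=
  ∫ x in Ω, energyDensity α β d u x

end

/-! Formally, differentiating the energy, integrating by parts and inserting the equation gives the
claim, but this needs the mixed derivative of `S` in time and space, which the regularity class does
not supply. Instead the difference quotient is integrated by parts. Green's formula for the
difference `v = S s - S t` and the field `W = ∇S s + ∇S t` turns `‖∇S s‖² - ‖∇S t‖²`, which is the
inner product of `∇v` with `W`, into `-v * div W`. Dividing by `s - t`, only the time quotient of
`S` remains. It is bounded, so dominated convergence applies, and the equation identifies the limit.

Green's formula rests on a divergence theorem for tangential fields on Lipschitz domains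
(`IsBoundedLipschitzDomain.integral_divergence_eq_zero`), proved without surface measure. A
partition of unity reduces it to balls. Near the boundary, written as `{h = 0}`, a cutoff in `h / δ`
has gradient of size `1 / δ` on a strip of measure `O(δ)`. There the pairing of the field with `∇h`
is small, because it vanishes at the boundary point reached along the graph direction `e`.
Rademacher's theorem supplies `∇h` almost everywhere. -/

noncomputable section

open scoped Manifold

variable {n : ℕ}

/-! ### Integration by parts in the interior -/

theorem exists_contDiff_cutoff {K U : Set (EuclideanSpace ℝ (Fin n))} (hK : IsCompact K)
    (hU : IsOpen U) (hKU : K ⊆ U) :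
    ∃ η : EuclideanSpace ℝ (Fin n) → ℝ, ContDiff ℝ 1 η ∧ HasCompactSupport η ∧ tsupport η ⊆ U ∧
      ∀ x ∈ K, ∀ᶠ y in 𝓝 x, η y = 1 := by
  obtain ⟨L, hL, hKL, hLU⟩ := exists_compact_between hK hU hKU
  obtain ⟨f, hf1, hf0, -⟩ := exists_contMDiffMap_one_nhds_of_subset_interior
    (n := 1) 𝓘(ℝ, EuclideanSpace ℝ (Fin n)) hK.isClosed hKL
  have hsub : tsupport f ⊆ L := by
    refine closure_minimal (fun x hx => ?_) hL.isClosed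
    by_contra h
    exact hx (hf0 x h)
  refine ⟨f, f.contMDiff.contDiff, hL.of_isClosed_subset (isClosed_tsupport _) hsub,
    hsub.trans hLU, fun x hx => ?_⟩
  exact eventually_nhdsSet_iff_forall.1 hf1 x hx

theorem ContDiffOn.contDiff_mul_of_tsupport_subset {U : Set (EuclideanSpace ℝ (Fin n))}
    (hU : IsOpen U) {η f : EuclideanSpace ℝ (Fin n) → ℝ} (hη : ContDiff ℝ 1 η)
    (hf : ContDiffOn ℝ 1 f U) (hsub : tsupport η ⊆ U) : ContDiff ℝ 1 (fun x => η x * f x) := by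
  rw [contDiff_iff_contDiffAt]
  intro x
  by_cases hx : x ∈ tsupport η
  · exact hη.contDiffAt.mul (hf.contDiffAt (hU.mem_nhds (hsub hx)))
  · have h0 : (fun x => η x * f x) =ᶠ[𝓝 x] fun _ => 0 := by
      filter_upwards [notMem_tsupport_iff_eventuallyEq.1 hx] with y hy
      simp [hy]
    exact contDiffAt_const.congr_of_eventuallyEq h0

theorem sum_apply_single (L : EuclideanSpace ℝ (Fin n) →L[ℝ] ℝ) (v : EuclideanSpace ℝ (Fin n)) :
    ∑ i, L (EuclideanSpace.single i 1) * v i = L v := by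
  conv_rhs => rw [← (EuclideanSpace.basisFun (Fin n) ℝ).sum_repr v]
  simp [map_sum, mul_comm]

/-- Integration by parts of a `C¹` vector field against a Lipschitz function whose support is a
compact subset of `Ω`. -/
theorem integral_lipschitz_mul_divergence {Ω : Set (EuclideanSpace ℝ (Fin n))} (hΩ : IsOpen Ω)
    {F : EuclideanSpace ℝ (Fin n) → EuclideanSpace ℝ (Fin n)} (hF : ContDiffOn ℝ 1 F Ω)
    {g : EuclideanSpace ℝ (Fin n) → ℝ} {C : ℝ≥0} (hg : LipschitzWith C g)
    (hgc : HasCompactSupport g) (hgΩ : tsupport g ⊆ Ω) :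
    IntegrableOn (fun x => g x * divergence F x + fderiv ℝ g x (F x)) Ω ∧
      ∫ x in Ω, (g x * divergence F x + fderiv ℝ g x (F x)) = 0 := by
  -- `F` is regular only inside `Ω`. Multiplying by `η`, which is 1 near the support of `g`, gives
  -- global compactly supported `C¹` components without changing the integrand.
  obtain ⟨η, hη, hηc, hηΩ, hη1⟩ := exists_contDiff_cutoff hgc hΩ hgΩ
  set e : Fin n → EuclideanSpace ℝ (Fin n) := fun i => EuclideanSpace.single i 1 with he
  have hFi (i : Fin n) : ContDiffOn ℝ 1 (fun x => F x i) Ω := by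
    exact contDiffOn_euclidean.1 hF i
  set f : Fin n → EuclideanSpace ℝ (Fin n) → ℝ := fun i x => η x * F x i with hfdef
  have hf (i : Fin n) : ContDiff ℝ 1 (f i) := (hFi i).contDiff_mul_of_tsupport_subset hΩ hη hηΩ
  have hfc (i : Fin n) : HasCompactSupport (f i) := hηc.mul_right
  have hfL (i : Fin n) : ∃ D, LipschitzWith D (f i) :=
    (hf i).lipschitzWith_of_hasCompactSupport (hfc i) one_ne_zero
  have hint1 (i : Fin n) : Integrable (fun x => lineDeriv ℝ (f i) x (e i) * g x) := by
    have : (fun x => lineDeriv ℝ (f i) x (e i) * g x) = fun x => fderiv ℝ (f i) x (e i) * g x := by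
      ext x
      rw [((hf i).differentiable one_ne_zero x).lineDeriv_eq_fderiv]
    rw [this]
    have h1 : Continuous fun x => fderiv ℝ (f i) x (e i) :=
      ((hf i).continuous_fderiv one_ne_zero).clm_apply continuous_const
    exact (h1.mul hg.continuous).integrable_of_hasCompactSupport hgc.mul_left
  have hint2 (i : Fin n) : Integrable (fun x => lineDeriv ℝ g x (-e i) * f i x) := by
    refine ((hf i).continuous.integrable_of_hasCompactSupport (hfc i)).bdd_mul (c := C * ‖-e i‖)
      (aestronglyMeasurable_lineDeriv hg.continuous _) (ae_of_all _ fun x => ?_)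
    exact norm_lineDeriv_le_of_lipschitz ℝ hg
  have hint3 (i : Fin n) :
      Integrable (fun x => lineDeriv ℝ (f i) x (e i) * g x - lineDeriv ℝ g x (-e i) * f i x) :=
    (hint1 i).sub (hint2 i)
  have hsum : ∫ x, ∑ i, (lineDeriv ℝ (f i) x (e i) * g x - lineDeriv ℝ g x (-e i) * f i x) = 0 := by
    rw [integral_finsetSum _ fun i _ => hint3 i]
    refine Finset.sum_eq_zero fun i _ => ?_
    obtain ⟨D, hD⟩ := hfL i
    rw [integral_sub (hint1 i) (hint2 i), hD.integral_lineDeriv_mul_eq hg hgc, sub_self]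
  have hae : (fun x => ∑ i, (lineDeriv ℝ (f i) x (e i) * g x - lineDeriv ℝ g x (-e i) * f i x))
      =ᵐ[volume] fun x => g x * divergence F x + fderiv ℝ g x (F x) := by
    -- By Rademacher, the directional derivatives of `g` assemble into `fderiv` almost everywhere.
    filter_upwards [hg.ae_differentiableAt] with x hx
    by_cases hxg : x ∈ tsupport g
    · rw [← sum_apply_single (fderiv ℝ g x) (F x), divergence, Finset.mul_sum,
        ← Finset.sum_add_distrib]
      refine Finset.sum_congr rfl fun i _ => ?_
      have h1 : f i =ᶠ[𝓝 x] fun y => F y i := by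
        filter_upwards [hη1 x hxg] with y hy
        simp [hfdef, hy]
      rw [((hf i).differentiable one_ne_zero x).lineDeriv_eq_fderiv, h1.fderiv_eq, h1.self_of_nhds,
        hx.lineDeriv_eq_fderiv, map_neg]
      ring
    · have h0 := notMem_tsupport_iff_eventuallyEq.1 hxg
      have h1 : fderiv ℝ g x = 0 := by
        rw [h0.fderiv_eq]; simp
      simp [h0.self_of_nhds, h1, hx.lineDeriv_eq_fderiv]
  have hint : Integrable fun x => g x * divergence F x + fderiv ℝ g x (F x) :=
    (integrable_finsetSum _ fun i _ => hint3 i).congr hae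
  refine ⟨hint.integrableOn, ?_⟩
  rw [setIntegral_eq_integral_of_forall_compl_eq_zero, ← integral_congr_ae hae, hsum]
  intro x hx
  have h0 := notMem_tsupport_iff_eventuallyEq.1 fun h => hx (hgΩ h)
  have h1 : fderiv ℝ g x = 0 := by
    rw [h0.fderiv_eq]; simp
  simp [h0.self_of_nhds, h1]

/-! ### Boundary charts: normals and thin strips -/

theorem mem_closure_of_chart {Ω : Set (EuclideanSpace ℝ (Fin n))}
    {h : EuclideanSpace ℝ (Fin n) → ℝ} {e x : EuclideanSpace ℝ (Fin n)}
    (he : ∀ y s, h (y + s • e) = h y + s) (hΩ : ∀ᶠ y in 𝓝 x, (y ∈ Ω ↔ 0 < h y)) (hx : h x = 0) :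
    x ∈ closure Ω := by
  -- Moving from `x` in direction `e` makes `h` positive at once, so these points lie in `Ω`.
  have hline : Tendsto (fun s : ℝ => x + s • e) (𝓝[>] 0) (𝓝 x) := by
    have : Continuous fun s : ℝ => x + s • e := by fun_prop
    simpa using (this.tendsto 0).mono_left nhdsWithin_le_nhds
  refine mem_closure_of_tendsto hline ?_
  filter_upwards [hline.eventually hΩ, self_mem_nhdsWithin] with s hs hs0
  rw [hs, he, hx]
  simpa using hs0

/-- Points of a boundary chart `{h > 0}` at which the defining function `h` is differentiable have
an outer unit normal, and the derivative of `h` is a multiple of the pairing with it. -/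
theorem apply_eq_zero_of_forall_isOuterUnitNormal {Ω : Set (EuclideanSpace ℝ (Fin n))}
    {h : EuclideanSpace ℝ (Fin n) → ℝ} {e x : EuclideanSpace ℝ (Fin n)}
    (he : ∀ y s, h (y + s • e) = h y + s) (hΩ : ∀ᶠ y in 𝓝 x, (y ∈ Ω ↔ 0 < h y)) (hx : h x = 0)
    {L : EuclideanSpace ℝ (Fin n) →L[ℝ] ℝ} (hL : HasFDerivAt h L x)
    {w : EuclideanSpace ℝ (Fin n)} (hw : ∀ ν, IsOuterUnitNormal Ω x ν → ⟪w, ν⟫ = 0) : L w = 0 := by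
  set p := (InnerProductSpace.toDual ℝ (EuclideanSpace ℝ (Fin n))).symm L with hp
  have hLp (v) : L v = ⟪p, v⟫ := by simp [hp]
  -- The gradient `p` of `h` is nonzero because `h` has slope 1 along `e`.
  have hp0 : 0 < ‖p‖ := by
    rw [norm_pos_iff]
    intro h0
    have h1 : HasDerivAt (fun s : ℝ => h (x + s • e)) (L e) 0 := by
      have h2 : HasDerivAt (fun s : ℝ => x + s • e) e 0 := by
        simpa using ((hasDerivAt_id (0 : ℝ)).smul_const e).const_add x
      have h3 : HasFDerivAt h L (x + (0 : ℝ) • e) := by simpa using hL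
      exact h3.comp_hasDerivAt 0 h2
    have h2 : HasDerivAt (fun s : ℝ => h (x + s • e)) 1 0 := by
      simp_rw [he]
      simpa using (hasDerivAt_id (0 : ℝ)).const_add (h x)
    have := h1.unique h2
    rw [hLp, h0] at this
    simp at this
  have hfr : x ∈ frontier Ω := by
    rw [frontier_eq_closure_inter_closure]
    refine ⟨mem_closure_of_chart he hΩ hx, subset_closure fun hxΩ => ?_⟩
    exact (hΩ.self_of_nhds.1 hxΩ).ne' hx
  -- `h` increases into `Ω`, so the outer normal is minus its normalized gradient.
  have hν : IsOuterUnitNormal Ω x (-(‖p‖⁻¹ • p)) := by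
    refine ⟨hfr, by rw [norm_neg, norm_smul, norm_inv, norm_norm, inv_mul_cancel₀ hp0.ne'],
      fun ε hε => ?_⟩
    have ho := hL.isLittleO.def (show 0 < ε * ‖p‖ by positivity)
    filter_upwards [ho, hΩ] with y hy hyΩ
    rw [hx, sub_zero, hLp, Real.norm_eq_abs, abs_le] at hy
    have hin : ⟪y - x, -(‖p‖⁻¹ • p)⟫ = -(‖p‖⁻¹ * ⟪p, y - x⟫) := by
      rw [inner_neg_right, inner_smul_right, real_inner_comm]
    have hmul : ‖p‖ * (‖p‖⁻¹ * ⟪p, y - x⟫) = ⟪p, y - x⟫ := by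
      rw [mul_inv_cancel_left₀ hp0.ne']
    rw [hin]
    constructor
    · intro h1
      rw [hyΩ]
      have := mul_lt_mul_of_pos_left h1 hp0
      nlinarith
    · intro h1
      rw [hyΩ]
      have := mul_lt_mul_of_pos_left h1 hp0
      nlinarith
  have := hw _ hν
  rw [inner_neg_right, inner_smul_right, real_inner_comm, neg_eq_zero] at this
  rw [hLp]
  exact (mul_eq_zero.1 this).resolve_left (inv_ne_zero hp0.ne')

/-- A strip of width `δ` along a graph has measure `O(δ)`. -/
theorem measureReal_graph_strip_le {h : EuclideanSpace ℝ (Fin n) → ℝ} (hm : Measurable h)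
    {e : EuclideanSpace ℝ (Fin n)} (hen : ‖e‖ = 1) (he : ∀ y s, h (y + s • e) = h y + s)
    (x₀ : EuclideanSpace ℝ (Fin n)) (R : ℝ) {δ : ℝ} (hδ : 0 < δ) (hδ1 : δ ≤ 1) :
    volume.real (Metric.closedBall x₀ R ∩ h ⁻¹' Ico δ (2 * δ)) ≤
      2 * δ * volume.real (Metric.closedBall x₀ (R + 1)) := by
  set A := Metric.closedBall x₀ R ∩ h ⁻¹' Ico δ (2 * δ) with hA
  have hAm : MeasurableSet A := measurableSet_closedBall.inter (hm measurableSet_Ico)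
  -- Translate the strip by `j * δ` along `e` for `j < N`. The half-open ranges of `h` are disjoint,
  -- and `N * δ ≤ 1` keeps all copies in the ball of radius `R + 1`. Comparing volumes with `N ≥ 1 /
  -- (2 * δ)` gives the bound.
  set N := ⌊1 / δ⌋₊ with hN
  have hN1 : (N : ℝ) * δ ≤ 1 := by
    have := Nat.floor_le (show 0 ≤ 1 / δ by positivity)
    rwa [le_div_iff₀ hδ] at this
  have hN2 : 1 ≤ 2 * δ * N := by
    have h1 : 1 ≤ 1 / δ := by rwa [le_div_iff₀ hδ, one_mul]
    have h2 : (1 : ℝ) ≤ N := by exact_mod_cast Nat.le_floor (by simpa using h1)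
    have h3 := Nat.lt_floor_add_one (1 / δ)
    rw [div_lt_iff₀ hδ] at h3
    rw [← hN] at h3
    nlinarith
  set B : ℕ → Set (EuclideanSpace ℝ (Fin n)) := fun j => (fun y => y + (-(j * δ) • e)) ⁻¹' A with hB
  have hBm (j) : MeasurableSet (B j) := hAm.preimage (by fun_prop)
  have hBv (j) : volume (B j) = volume A := measure_preimage_add_right _ _ _
  have hBsub : (⋃ j ∈ Finset.range N, B j) ⊆ Metric.closedBall x₀ (R + 1) := by
    intro y hy
    simp only [mem_iUnion, Finset.mem_range] at hy
    obtain ⟨j, hj, hy⟩ := hy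
    have h1 : dist (y + (-(j * δ) • e)) x₀ ≤ R := hy.1
    have h2 : dist y (y + (-(j * δ) • e)) ≤ 1 := by
      rw [dist_self_add_right, norm_smul, hen, mul_one, norm_neg, Real.norm_of_nonneg (by positivity)]
      refine le_trans ?_ hN1
      gcongr
    have := dist_triangle y (y + (-(j * δ) • e)) x₀
    rw [Metric.mem_closedBall]
    linarith
  have hdisj : Set.PairwiseDisjoint (↑(Finset.range N)) B := by
    intro i _ j _ hij
    rw [Function.onFun, Set.disjoint_left]
    intro y hyi hyj
    have hi := hyi.2
    have hj := hyj.2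
    simp only [mem_preimage, he, mem_Ico] at hi hj
    apply hij
    have h1 : (i : ℝ) < j + 1 := by nlinarith
    have h2 : (j : ℝ) < i + 1 := by nlinarith
    have h1' : i < j + 1 := by exact_mod_cast h1
    have h2' : j < i + 1 := by exact_mod_cast h2
    omega
  have hle : N * volume A ≤ volume (Metric.closedBall x₀ (R + 1)) := by
    have := measure_mono (μ := volume) hBsub
    rw [measure_biUnion_finset hdisj fun j _ => hBm j] at this
    simpa [hBv] using this
  have hle' : N * volume.real A ≤ volume.real (Metric.closedBall x₀ (R + 1)) := by
    have := ENNReal.toReal_mono measure_closedBall_lt_top.ne hle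
    simpa [Measure.real] using this
  have h0 : 0 ≤ volume.real A := measureReal_nonneg
  nlinarith

/-! ### Lipschitz cutoffs from the smooth step -/

theorem LipschitzWith.mul_of_bounded {X : Type*} [PseudoMetricSpace X] {f g : X → ℝ} {A B : ℝ≥0}
    (hf : LipschitzWith A f) (hg : LipschitzWith B g) {M : ℝ≥0} (hfM : ∀ x, |f x| ≤ M)
    (hg1 : ∀ x, |g x| ≤ 1) : LipschitzWith (A + M * B) (fun x => f x * g x) := by
  refine LipschitzWith.of_dist_le_mul fun x y => ?_
  have h1 := hf.dist_le_mul x y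
  have h2 := hg.dist_le_mul x y
  rw [Real.dist_eq] at h1 h2 ⊢
  have h3 : f x * g x - f y * g y = (f x - f y) * g x + f y * (g x - g y) := by ring
  calc |f x * g x - f y * g y| ≤ |f x - f y| * |g x| + |f y| * |g x - g y| := by
        rw [h3, ← abs_mul, ← abs_mul]; exact abs_add_le _ _
    _ ≤ (A * dist x y) * 1 + M * (B * dist x y) := by
        gcongr
        · exact hg1 x
        · exact hfM y
    _ = _ := by push_cast; ring

/-- Outside the open unit interval the step attains its global minimum 0 or maximum 1, so Fermat's
criterion applies, endpoints included. -/
theorem deriv_smoothTransition_eq_zero {s : ℝ} (hs : s ∉ Ioo (0 : ℝ) 1) :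
    deriv Real.smoothTransition s = 0 := by
  rcases le_or_gt s 0 with h | h
  · refine IsLocalMin.deriv_eq_zero (Filter.Eventually.of_forall fun t => ?_)
    rw [Real.smoothTransition.zero_of_nonpos h]
    exact Real.smoothTransition.nonneg t
  · have h1 : 1 ≤ s := not_lt.1 fun h1 => hs ⟨h, h1⟩
    refine IsLocalMax.deriv_eq_zero (Filter.Eventually.of_forall fun t => ?_)
    rw [Real.smoothTransition.one_of_one_le h1]
    exact Real.smoothTransition.le_one t

theorem exists_abs_deriv_smoothTransition_le :
    ∃ C : ℝ≥0, ∀ s, |deriv Real.smoothTransition s| ≤ C := by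
  have hc : ContinuousOn (deriv Real.smoothTransition) (Icc 0 1) :=
    ((Real.smoothTransition.contDiff (n := 1)).continuous_deriv le_rfl).continuousOn
  obtain ⟨C, hC⟩ := isCompact_Icc.exists_bound_of_continuousOn hc
  refine ⟨C.toNNReal, fun s => ?_⟩
  by_cases hs : s ∈ Ioo (0 : ℝ) 1
  · exact (hC s (Ioo_subset_Icc_self hs)).trans (Real.le_coe_toNNReal C)
  · rw [deriv_smoothTransition_eq_zero hs, abs_zero]
    exact NNReal.coe_nonneg _

theorem exists_lipschitzWith_smoothTransition : ∃ C, LipschitzWith C Real.smoothTransition := by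
  obtain ⟨C, hC⟩ := exists_abs_deriv_smoothTransition_le
  refine ⟨C, lipschitzWith_of_nnnorm_deriv_le
    ((Real.smoothTransition.contDiff (n := 1)).differentiable one_ne_zero) fun s => ?_⟩
  exact_mod_cast hC s

/-! ### The divergence theorem for tangential fields -/

theorem integrableOn_mul_divergence_add {Ω : Set (EuclideanSpace ℝ (Fin n))}
    (hΩb : Bornology.IsBounded Ω)
    {F : EuclideanSpace ℝ (Fin n) → EuclideanSpace ℝ (Fin n)}
    (hFc : ContinuousOn F (closure Ω)) (hdiv : IntegrableOn (divergence F) Ω)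
    {φ : EuclideanSpace ℝ (Fin n) → ℝ} (hφ : ContDiff ℝ 1 φ) (hφc : HasCompactSupport φ) :
    IntegrableOn (fun x => φ x * divergence F x + fderiv ℝ φ x (F x)) Ω := by
  obtain ⟨M, hM⟩ := hφc.exists_bound_of_continuous hφ.continuous
  have h1 : IntegrableOn (fun x => φ x * divergence F x) Ω :=
    hdiv.bdd_mul hφ.continuous.aestronglyMeasurable (ae_of_all _ hM)
  have h2 : IntegrableOn (fun x => fderiv ℝ φ x (F x)) (closure Ω) :=
    ((hφ.continuous_fderiv one_ne_zero).continuousOn.clm_apply hFc).integrableOn_compact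
      hΩb.isCompact_closure
  exact h1.add (h2.mono_set subset_closure)

/-- Divergence theorem, tested with a function supported in a boundary chart `{h > 0}`, for vector
fields which are tangential on the boundary. -/
theorem integral_mul_divergence_of_chart {Ω : Set (EuclideanSpace ℝ (Fin n))}
    (hΩ : IsOpen Ω) (hΩb : Bornology.IsBounded Ω)
    {F : EuclideanSpace ℝ (Fin n) → EuclideanSpace ℝ (Fin n)} (hF : ContDiffOn ℝ 1 F Ω)
    (hFc : ContinuousOn F (closure Ω)) (hdiv : IntegrableOn (divergence F) Ω)
    (hν : ∀ x ν, IsOuterUnitNormal Ω x ν → ⟪F x, ν⟫ = 0)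
    {h : EuclideanSpace ℝ (Fin n) → ℝ} {L : ℝ≥0} (hh : LipschitzWith L h)
    {e : EuclideanSpace ℝ (Fin n)} (hen : ‖e‖ = 1) (he : ∀ y s, h (y + s • e) = h y + s)
    {x₀ : EuclideanSpace ℝ (Fin n)} {r : ℝ} (hchart : ∀ y ∈ Metric.ball x₀ r, (y ∈ Ω ↔ 0 < h y))
    {φ : EuclideanSpace ℝ (Fin n) → ℝ} (hφ : ContDiff ℝ 1 φ) (hφc : HasCompactSupport φ)
    (hφr : tsupport φ ⊆ Metric.ball x₀ r) :
    ∫ x in Ω, (φ x * divergence F x + fderiv ℝ φ x (F x)) = 0 := by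
  set I : EuclideanSpace ℝ (Fin n) → ℝ := fun x => φ x * divergence F x + fderiv ℝ φ x (F x) with hI
  have hIint : IntegrableOn I Ω := integrableOn_mul_divergence_add hΩb hFc hdiv hφ hφc
  set σ := Real.smoothTransition with hσ
  have hσd : Differentiable ℝ σ := (Real.smoothTransition.contDiff (n := 1)).differentiable one_ne_zero
  have hσ1 (s) : |σ s| ≤ 1 :=
    abs_le.2 ⟨by linarith [Real.smoothTransition.nonneg s], Real.smoothTransition.le_one s⟩
  obtain ⟨C, hC⟩ := exists_abs_deriv_smoothTransition_le
  obtain ⟨C', hC'⟩ := exists_lipschitzWith_smoothTransition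
  obtain ⟨M, hM⟩ : ∃ M : ℝ≥0, ∀ x, |φ x| ≤ M := by
    obtain ⟨M, hM⟩ := hφc.exists_bound_of_continuous hφ.continuous
    exact ⟨M.toNNReal, fun x => (hM x).trans (Real.le_coe_toNNReal M)⟩
  obtain ⟨ρ, hρ, hρr⟩ := hφc.exists_thickening_subset_open Metric.isOpen_ball hφr
  obtain ⟨D, hD⟩ := hφ.lipschitzWith_of_hasCompactSupport hφc one_ne_zero
  -- At a point of `Ω` in the chart, `h` is positive and the cutoff equals 1 once `δ` is small. Off
  -- the chart `I` vanishes.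
  have hlim : Tendsto (fun δ : ℝ => ∫ x in Ω, σ (δ⁻¹ * h x - 1) * I x) (𝓝[>] 0)
      (𝓝 (∫ x in Ω, I x)) := by
    refine tendsto_integral_filter_of_dominated_convergence (fun x => ‖I x‖) ?_ ?_ hIint.norm ?_
    · refine Filter.Eventually.of_forall fun δ => ?_
      refine Continuous.aestronglyMeasurable ?_ |>.mul hIint.aestronglyMeasurable
      exact Real.smoothTransition.continuous.comp (by have := hh.continuous; fun_prop)
    · refine Filter.Eventually.of_forall fun δ => ae_of_all _ fun x => ?_
      rw [norm_mul]
      exact mul_le_of_le_one_left (norm_nonneg _) (hσ1 _)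
    · refine (ae_restrict_mem hΩ.measurableSet).mono fun x hx => ?_
      by_cases hxr : x ∈ Metric.ball x₀ r
      · have hpos := (hchart x hxr).1 hx
        refine tendsto_const_nhds.congr' ?_
        have : Tendsto (fun δ : ℝ => δ⁻¹ * h x - 1) (𝓝[>] 0) atTop :=
          tendsto_atTop_add_const_right _ _ (tendsto_inv_nhdsGT_zero.atTop_mul_const hpos)
        filter_upwards [this.eventually_ge_atTop 1] with δ hδ
        rw [hσ, Real.smoothTransition.one_of_one_le hδ, one_mul]
      · have h0 := notMem_tsupport_iff_eventuallyEq.1 fun h => hxr (hφr h)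
        have : I x = 0 := by
          simp only [hI]
          rw [h0.fderiv_eq, h0.self_of_nhds]
          simp
        simp [this]
  have hbound (ε : ℝ) (hε : 0 < ε) : |∫ x in Ω, I x| ≤
      2 * M * C * L * volume.real (Metric.closedBall x₀ (r + 1)) * ε := by
    have huc := hΩb.isCompact_closure.uniformContinuousOn_of_continuous hFc
    obtain ⟨τ, hτ, hτF⟩ := Metric.uniformContinuousOn_iff.1 huc ε hε
    refine le_of_tendsto hlim.abs ?_
    -- Points of the strip satisfy `h < 2 * δ`. Thus `2 * δ < ρ` keeps their projection along `e` in
    -- the chart, and `2 * δ < τ` makes `F` vary by less than `ε` on the way.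
    have hsmall : ∀ᶠ δ : ℝ in 𝓝[>] 0, δ < min 1 (min (ρ / 2) (τ / 2)) :=
      nhdsWithin_le_nhds (gt_mem_nhds (by positivity))
    filter_upwards [self_mem_nhdsWithin, hsmall] with δ (hδ : 0 < δ) hδs
    obtain ⟨hδ1, hδρ, hδτ⟩ : δ < 1 ∧ δ < ρ / 2 ∧ δ < τ / 2 := by simpa using hδs
    set χ : EuclideanSpace ℝ (Fin n) → ℝ := fun x => σ (δ⁻¹ * h x - 1) with hχ
    have hχL : LipschitzWith (C' * (δ⁻¹.toNNReal * L)) χ := by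
      refine hC'.comp (LipschitzWith.of_dist_le_mul fun x y => ?_)
      have := hh.dist_le_mul x y
      rw [Real.dist_eq] at this ⊢
      have h1 : δ⁻¹ * h x - 1 - (δ⁻¹ * h y - 1) = δ⁻¹ * (h x - h y) := by ring
      rw [h1, abs_mul, abs_of_pos (inv_pos.2 hδ)]
      push_cast
      rw [Real.coe_toNNReal _ (inv_pos.2 hδ).le, mul_assoc]
      gcongr
    have hgL : LipschitzWith _ (fun x => φ x * χ x) := hD.mul_of_bounded hχL hM fun x => hσ1 _
    have hgc : HasCompactSupport (fun x => φ x * χ x) := hφc.mul_right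
    have hgΩ : tsupport (fun x => φ x * χ x) ⊆ Ω := by
      have hsub : tsupport (fun x => φ x * χ x) ⊆ tsupport φ ∩ {x | δ ≤ h x} := by
        refine closure_minimal (fun x hx => ?_)
          ((isClosed_tsupport _).inter (isClosed_le continuous_const hh.continuous))
        refine ⟨subset_tsupport _ (left_ne_zero_of_mul hx), ?_⟩
        have h1 : ¬ (δ⁻¹ * h x - 1 ≤ 0) := fun h0 =>
          right_ne_zero_of_mul hx (Real.smoothTransition.zero_of_nonpos h0)
        rw [not_le, sub_pos, inv_mul_eq_div, one_lt_div hδ] at h1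
        exact h1.le
      intro x hx
      obtain ⟨h1, h2⟩ := hsub hx
      exact (hchart x (hφr h1)).2 (hδ.trans_le h2)
    obtain ⟨hint, hzero⟩ := integral_lipschitz_mul_divergence hΩ hF hgL hgc hgΩ
    have hχI : IntegrableOn (fun x => χ x * I x) Ω :=
      hIint.bdd_mul hχL.continuous.aestronglyMeasurable (ae_of_all _ fun x => hσ1 _)
    set A := Metric.closedBall x₀ r ∩ h ⁻¹' Ico δ (2 * δ) with hA
    have hAm : MeasurableSet A :=
      measurableSet_closedBall.inter (hh.continuous.measurable measurableSet_Ico)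
    have hAfin : volume A ≠ ⊤ :=
      (measure_mono inter_subset_left |>.trans_lt measure_closedBall_lt_top).ne
    -- The factors bound `φ`, the derivative of the step at scale `δ`, and the pairing of `∇h` with
    -- `F`.
    set c : ℝ := M * (C * δ⁻¹) * (L * ε) with hc
    have hc0 : 0 ≤ c := by positivity
    have hpt : ∀ᵐ x ∂(volume.restrict Ω), ‖χ x * I x - (φ x * χ x * divergence F x +
        fderiv ℝ (fun x => φ x * χ x) x (F x))‖ ≤ A.indicator (fun _ => c) x := by
      filter_upwards [ae_restrict_of_ae hh.ae_differentiableAt, ae_restrict_mem hΩ.measurableSet]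
        with x hx hxΩ
      have hχd : HasFDerivAt χ ((deriv σ (δ⁻¹ * h x - 1) * δ⁻¹) • fderiv ℝ h x) x := by
        have h1 : HasFDerivAt (fun y => δ⁻¹ * h y - 1) (δ⁻¹ • fderiv ℝ h x) x :=
          (hx.hasFDerivAt.const_mul _).sub_const _
        have := (hσd (δ⁻¹ * h x - 1)).hasDerivAt.comp_hasFDerivAt x h1
        rwa [smul_smul] at this
      have hgd : fderiv ℝ (fun x => φ x * χ x) x (F x) =
          φ x * (deriv σ (δ⁻¹ * h x - 1) * δ⁻¹ * fderiv ℝ h x (F x)) +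
            χ x * fderiv ℝ φ x (F x) := by
        rw [((hφ.differentiable one_ne_zero x).hasFDerivAt.fun_mul hχd).fderiv]
        simp
      have heq : χ x * I x - (φ x * χ x * divergence F x + fderiv ℝ (fun x => φ x * χ x) x (F x)) =
          -(φ x * (deriv σ (δ⁻¹ * h x - 1) * δ⁻¹) * fderiv ℝ h x (F x)) := by
        rw [hgd]; simp only [hI]; ring
      rw [heq, norm_neg]
      have hnn : 0 ≤ A.indicator (fun _ => c) x := indicator_nonneg (fun _ _ => hc0) x
      by_cases hφx : φ x = 0
      · simpa [hφx] using hnn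
      by_cases hs : δ⁻¹ * h x - 1 ∈ Ioo (0 : ℝ) 1
      swap
      · simpa [hσ, deriv_smoothTransition_eq_zero hs] using hnn
      have hx1 : δ < h x := by
        have := hs.1
        rwa [sub_pos, inv_mul_eq_div, one_lt_div hδ] at this
      have hx2 : h x < 2 * δ := by
        have : δ⁻¹ * h x < 2 := by linarith [hs.2]
        rwa [inv_mul_eq_div, div_lt_iff₀ hδ] at this
      have hxs : x ∈ tsupport φ := subset_tsupport _ hφx
      have hxA : x ∈ A := ⟨Metric.ball_subset_closedBall (hφr hxs), hx1.le, hx2⟩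
      rw [indicator_of_mem hxA]
      -- Projection of `x` onto the boundary along `e`.
      set y := x + (-h x) • e with hy
      have hdist : dist x y = h x := by
        rw [hy, dist_self_add_right, norm_smul, hen, mul_one, norm_neg,
          Real.norm_of_nonneg (hδ.trans hx1).le]
      have hyr : y ∈ Metric.ball x₀ r := by
        refine hρr (Metric.mem_thickening_iff.2 ⟨x, hxs, ?_⟩)
        rw [dist_comm, hdist]; linarith
      have hy0 : h y = 0 := by rw [hy, he]; ring
      have hchart' : ∀ᶠ z in 𝓝 y, (z ∈ Ω ↔ 0 < h z) := by
        filter_upwards [Metric.isOpen_ball.mem_nhds hyr] with z hz using hchart z hz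
      have hyc : y ∈ closure Ω := mem_closure_of_chart he hchart' hy0
      -- `h` changes by a constant under translation along `e`, so differentiability at `x` passes
      -- to the boundary point `y` with the same derivative. Almost every `x` in the volume sense
      -- therefore suffices.
      have hyd : HasFDerivAt h (fderiv ℝ h x) y := by
        have h1 : HasFDerivAt (fun z => z + h x • e) (ContinuousLinearMap.id ℝ _) y :=
          (hasFDerivAt_id y).add_const _
        have h2 : y + h x • e = x := by rw [hy]; module
        have h3 : HasFDerivAt h (fderiv ℝ h x) (y + h x • e) := by rw [h2]; exact hx.hasFDerivAt
        have h4 := (h3.comp y h1).sub_const (h x)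
        have h5 : (fun z => (h ∘ fun z => z + h x • e) z - h x) = h := by
          ext z; simp [he]
        rw [h5] at h4
        simpa using h4
      have hFy : fderiv ℝ h x (F y) = 0 :=
        apply_eq_zero_of_forall_isOuterUnitNormal he hchart' hy0 hyd (hν y)
      have hFx : ‖fderiv ℝ h x (F x)‖ ≤ L * ε := by
        have h1 : fderiv ℝ h x (F x) = fderiv ℝ h x (F x - F y) := by rw [map_sub, hFy, sub_zero]
        rw [h1]
        refine (ContinuousLinearMap.le_opNorm _ _).trans ?_
        gcongr
        · exact norm_fderiv_le_of_lipschitz ℝ hh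
        · rw [← dist_eq_norm]
          exact (hτF x (subset_closure hxΩ) y hyc (by rw [hdist]; linarith)).le
      rw [norm_mul, norm_mul, norm_mul, Real.norm_of_nonneg (inv_pos.2 hδ).le, hc]
      gcongr
      · exact hM x
      · exact hC _
    have hJ : ∫ x in Ω, χ x * I x = ∫ x in Ω, (χ x * I x - (φ x * χ x * divergence F x +
        fderiv ℝ (fun x => φ x * χ x) x (F x))) := by
      rw [integral_sub hχI hint, hzero, sub_zero]
    have hind : Integrable (A.indicator fun _ => c) :=
      (integrable_indicator_iff hAm).2 (integrableOn_const hAfin)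
    calc |∫ x in Ω, χ x * I x| ≤ ∫ x in Ω, A.indicator (fun _ => c) x := by
          rw [hJ]
          exact norm_integral_le_of_norm_le hind.integrableOn hpt
      _ ≤ ∫ x, A.indicator (fun _ => c) x :=
          setIntegral_le_integral hind (ae_of_all _ fun x => indicator_nonneg (fun _ _ => hc0) x)
      _ = volume.real A * c := by
          rw [integral_indicator hAm, setIntegral_const, smul_eq_mul]
      _ ≤ (2 * δ * volume.real (Metric.closedBall x₀ (r + 1))) * c := by
          gcongr
          exact measureReal_graph_strip_le hh.continuous.measurable hen he x₀ r hδ hδ1.le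
      -- The `δ` from the strip cancels the `δ⁻¹` in `c`.
      _ = _ := by
          rw [hc]; field_simp
  set W := 2 * M * C * L * volume.real (Metric.closedBall x₀ (r + 1)) with hW
  have hW0 : 0 ≤ W := by positivity
  change ∫ x in Ω, I x = 0
  rw [← abs_nonpos_iff]
  refine le_of_forall_pos_le_add fun ε hε => ?_
  -- The `+ 1` covers the case `W = 0`.
  refine (hbound (ε / (W + 1)) (by positivity)).trans ?_
  rw [zero_add, mul_div_assoc', div_le_iff₀ (by positivity)]
  nlinarith

/-- The divergence theorem on bounded Lipschitz domains for vector fields whose normal component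
vanishes on the boundary. -/
theorem IsBoundedLipschitzDomain.integral_divergence_eq_zero {Ω : Set (EuclideanSpace ℝ (Fin n))}
    (hΩ : IsBoundedLipschitzDomain Ω)
    {F : EuclideanSpace ℝ (Fin n) → EuclideanSpace ℝ (Fin n)} (hF : ContDiffOn ℝ 1 F Ω)
    (hFc : ContinuousOn F (closure Ω)) (hdiv : IntegrableOn (divergence F) Ω)
    (hν : ∀ x ν, IsOuterUnitNormal Ω x ν → ⟪F x, ν⟫ = 0) :
    ∫ x in Ω, divergence F x = 0 := by
  have hlocal : ∀ x ∈ closure Ω, ∃ r : ℝ, 0 < r ∧ ∀ φ : EuclideanSpace ℝ (Fin n) → ℝ,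
      ContDiff ℝ 1 φ → HasCompactSupport φ → tsupport φ ⊆ Metric.ball x r →
        ∫ y in Ω, (φ y * divergence F y + fderiv ℝ φ y (F y)) = 0 := by
    intro x hx
    by_cases hxΩ : x ∈ Ω
    · obtain ⟨r, hr, hrΩ⟩ := Metric.isOpen_iff.1 hΩ.isOpen x hxΩ
      refine ⟨r, hr, fun φ hφ hφc hφr => ?_⟩
      obtain ⟨D, hD⟩ := hφ.lipschitzWith_of_hasCompactSupport hφc one_ne_zero
      exact (integral_lipschitz_mul_divergence hΩ.isOpen hF hD hφc (hφr.trans hrΩ)).2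
    · have hxf : x ∈ frontier Ω := by
        rw [hΩ.isOpen.frontier_eq]; exact ⟨hx, hxΩ⟩
      obtain ⟨e, g, K, r, he, hg, hr, hgr⟩ := hΩ.local_graph x hxf
      refine ⟨r, hr, fun φ hφ hφc hφr => ?_⟩
      -- `P` is the orthogonal projection onto the complement of `e`; it exhibits the graph's
      -- defining function as Lipschitz on the whole space.
      let P : EuclideanSpace ℝ (Fin n) →L[ℝ] EuclideanSpace ℝ (Fin n) :=
        ContinuousLinearMap.id ℝ _ - (innerSL ℝ e).smulRight e
      have hh : LipschitzWith (‖innerSL ℝ e‖₊ + K * ‖P‖₊) fun y => ⟪e, y⟫ - g (y - ⟪e, y⟫ • e) :=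
        (innerSL ℝ e).lipschitz.sub (hg.comp P.lipschitz)
      refine integral_mul_divergence_of_chart hΩ.isOpen hΩ.isBounded hF hFc hdiv hν hh he ?_
        (fun y hy => ?_) hφ hφc hφr
      · intro y s
        have h1 : ⟪e, y + s • e⟫ = ⟪e, y⟫ + s := by
          rw [inner_add_right, inner_smul_right, real_inner_self_eq_norm_sq, he]; ring
        have h2 : y + s • e - (⟪e, y⟫ + s) • e = y - ⟪e, y⟫ • e := by module
        simp only [h1, h2]
        ring
      · rw [hgr y hy, sub_pos]
  choose! r hr0 hr using hlocal
  obtain ⟨t, htΩ, ht⟩ := hΩ.isBounded.isCompact_closure.elim_nhds_subcover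
    (fun x => Metric.ball x (r x)) fun x hx => Metric.ball_mem_nhds x (hr0 x hx)
  obtain ⟨f, hf⟩ := SmoothPartitionOfUnity.exists_isSubordinate
    𝓘(ℝ, EuclideanSpace ℝ (Fin n)) (s := closure Ω) isClosed_closure
    (fun i : t => Metric.ball (i : EuclideanSpace ℝ (Fin n)) (r i))
    (fun i => Metric.isOpen_ball) (by simpa [iUnion_subtype] using ht)
  have hf1 (i) : ContDiff ℝ 1 (f i) := (f i).contMDiff.contDiff.of_le (by norm_cast)
  have hfc (i) : HasCompactSupport (f i) :=
    HasCompactSupport.of_support_subset_isCompact (isCompact_closedBall _ _)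
      ((subset_tsupport _).trans ((hf i).trans Metric.ball_subset_closedBall))
  have hsum (x) (hx : x ∈ Ω) : ∑ i, f i x = 1 := by
    rw [← finsum_eq_sum_of_fintype]; exact f.sum_eq_one (subset_closure hx)
  have hpt : ∀ x ∈ Ω, ∑ i, (f i x * divergence F x + fderiv ℝ (f i) x (F x)) = divergence F x := by
    intro x hx
    rw [Finset.sum_add_distrib, ← Finset.sum_mul, hsum x hx, one_mul]
    -- The partition sums to 1 near `x`, so the gradient terms cancel.
    have h1 : fderiv ℝ (fun y => ∑ i, f i y) x = 0 := by
      have : (fun y => ∑ i, f i y) =ᶠ[𝓝 x] fun _ => 1 := by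
        filter_upwards [hΩ.isOpen.mem_nhds hx] with y hy using hsum y hy
      rw [this.fderiv_eq]; simp
    rw [fderiv_fun_sum fun i _ => (hf1 i).differentiable one_ne_zero x] at h1
    rw [← _root_.sum_apply, h1]
    simp
  rw [← setIntegral_congr_fun hΩ.isOpen.measurableSet hpt, integral_finsetSum]
  · exact Finset.sum_eq_zero fun i _ => hr i (htΩ i i.2) (f i) (hf1 i) (hfc i) (hf i)
  · exact fun i _ => integrableOn_mul_divergence_add hΩ.isBounded hFc hdiv (hf1 i) (hfc i)

/-! ### Green's formula -/

/-- The trace `∑ᵢ (A eᵢ)ᵢ` of a linear map, in the standard basis. -/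
def coordTrace (A : EuclideanSpace ℝ (Fin n) →L[ℝ] EuclideanSpace ℝ (Fin n)) : ℝ :=
  ∑ i : Fin n, A (EuclideanSpace.single i 1) i

theorem continuous_coordTrace : Continuous (coordTrace (n := n)) := by
  unfold coordTrace
  fun_prop

theorem coordTrace_add (A B : EuclideanSpace ℝ (Fin n) →L[ℝ] EuclideanSpace ℝ (Fin n)) :
    coordTrace (A + B) = coordTrace A + coordTrace B := by
  simp [coordTrace, Finset.sum_add_distrib]

theorem coordTrace_smul (a : ℝ) (A : EuclideanSpace ℝ (Fin n) →L[ℝ] EuclideanSpace ℝ (Fin n)) :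
    coordTrace (a • A) = a * coordTrace A := by
  simp [coordTrace, Finset.mul_sum]

theorem HasFDerivAt.divergence {F : EuclideanSpace ℝ (Fin n) → EuclideanSpace ℝ (Fin n)}
    {A : EuclideanSpace ℝ (Fin n) →L[ℝ] EuclideanSpace ℝ (Fin n)} {x : EuclideanSpace ℝ (Fin n)}
    (h : HasFDerivAt F A x) : divergence F x = coordTrace A := by
  refine Finset.sum_congr rfl fun i _ => ?_
  have h1 : HasFDerivAt (fun y => F y i)
      ((EuclideanSpace.proj i : EuclideanSpace ℝ (Fin n) →L[ℝ] ℝ).comp A) x :=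
    (EuclideanSpace.proj i : EuclideanSpace ℝ (Fin n) →L[ℝ] ℝ).hasFDerivAt.comp x h
  rw [h1.fderiv]
  rfl

theorem contDiffOn_one_of_hasFDerivAt {E F : Type*} [NormedAddCommGroup E] [NormedSpace ℝ E]
    [NormedAddCommGroup F] [NormedSpace ℝ F] {U : Set E} (hU : IsOpen U) {f : E → F}
    {f' : E → E →L[ℝ] F} (hf : ∀ x ∈ U, HasFDerivAt f (f' x) x) (hf' : ContinuousOn f' U) :
    ContDiffOn ℝ 1 f U := by
  rw [show (1 : WithTop ℕ∞) = 0 + 1 by simp, contDiffOn_succ_iff_fderiv_of_isOpen hU]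
  refine ⟨fun x hx => (hf x hx).differentiableAt.differentiableWithinAt, by simp, ?_⟩
  rw [contDiffOn_zero]
  exact hf'.congr fun x hx => (hf x hx).fderiv

/-- Green's formula on bounded Lipschitz domains, for a tangential vector field `W`. -/
theorem IsBoundedLipschitzDomain.integral_green {Ω : Set (EuclideanSpace ℝ (Fin n))}
    (hΩ : IsBoundedLipschitzDomain Ω) {v : EuclideanSpace ℝ (Fin n) → ℝ}
    {V W : EuclideanSpace ℝ (Fin n) → EuclideanSpace ℝ (Fin n)}
    {H : EuclideanSpace ℝ (Fin n) → EuclideanSpace ℝ (Fin n) →L[ℝ] EuclideanSpace ℝ (Fin n)}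
    (hvc : ContinuousOn v (closure Ω)) (hVc : ContinuousOn V (closure Ω))
    (hWc : ContinuousOn W (closure Ω)) (hHc : ContinuousOn H (closure Ω))
    (hv : ∀ x ∈ Ω, HasFDerivAt v (innerSL ℝ (V x)) x) (hW : ∀ x ∈ Ω, HasFDerivAt W (H x) x)
    (hν : ∀ x ν, IsOuterUnitNormal Ω x ν → ⟪W x, ν⟫ = 0) :
    ∫ x in Ω, (v x * coordTrace (H x) + ⟪V x, W x⟫) = 0 := by
  have hF : ∀ x ∈ Ω, HasFDerivAt (fun y => v y • W y)
      (v x • H x + (innerSL ℝ (V x)).smulRight (W x)) x := fun x hx => (hv x hx).fun_smul (hW x hx)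
  have hdiv : ∀ x ∈ Ω, divergence (fun y => v y • W y) x =
      v x * coordTrace (H x) + ⟪V x, W x⟫ := by
    intro x hx
    rw [(hF x hx).divergence, coordTrace_add, coordTrace_smul]
    congr 1
    simpa [coordTrace] using sum_apply_single (innerSL ℝ (V x)) (W x)
  have hF'c : ContinuousOn (fun x => v x • H x + (innerSL ℝ (V x)).smulRight (W x))
      (closure Ω) := by
    refine (hvc.smul hHc).add ?_
    have h1 : ContinuousOn (fun x => innerSL ℝ (V x)) (closure Ω) :=
      (innerSL ℝ).continuous.comp_continuousOn hVc
    exact ((ContinuousLinearMap.smulRightL ℝ (EuclideanSpace ℝ (Fin n))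
      (EuclideanSpace ℝ (Fin n))).continuous.comp_continuousOn h1).clm_apply hWc
  have hint : IntegrableOn (fun x => v x * coordTrace (H x) + ⟪V x, W x⟫) (closure Ω) :=
    ((hvc.mul (continuous_coordTrace.comp_continuousOn hHc)).add
      (hVc.inner hWc)).integrableOn_compact hΩ.isBounded.isCompact_closure
  have hmeas := hΩ.isOpen.measurableSet
  rw [← setIntegral_congr_fun hmeas hdiv]
  refine hΩ.integral_divergence_eq_zero
    (contDiffOn_one_of_hasFDerivAt hΩ.isOpen hF (hF'c.mono subset_closure)) (hvc.smul hWc)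
    ((hint.mono_set subset_closure).congr_fun (fun x hx => (hdiv x hx).symm) hmeas)
    fun x ν hxν => ?_
  rw [inner_smul_left, hν x ν hxν, mul_zero]

/-! ### Extension of the derivatives to the closed cylinder -/

theorem ContinuousOn.uncurry_left' {X Y Z : Type*} [TopologicalSpace X] [TopologicalSpace Y]
    [TopologicalSpace Z] {f : X → Y → Z} {s : Set X} {t : Set Y}
    (hf : ContinuousOn (fun p : X × Y => f p.1 p.2) (s ×ˢ t)) {x : X} (hx : x ∈ s) :
    ContinuousOn (f x) t :=
  hf.comp (f := fun y => (x, y)) (by fun_prop) fun _ hy => ⟨hx, hy⟩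

theorem ContinuousOn.uncurry_right' {X Y Z : Type*} [TopologicalSpace X] [TopologicalSpace Y]
    [TopologicalSpace Z] {f : X → Y → Z} {s : Set X} {t : Set Y}
    (hf : ContinuousOn (fun p : X × Y => f p.1 p.2) (s ×ˢ t)) {y : Y} (hy : y ∈ t) :
    ContinuousOn (fun x => f x y) s :=
  hf.comp (f := fun x => (x, y)) (by fun_prop) fun _ hx => ⟨hx, hy⟩

/-- Density and continuity. It carries the equation and the boundary condition, imposed only for
positive times, to `t = 0`. -/
theorem eq_zero_on_Icc_of_Ioc {T : ℝ} (hT : 0 < T) {f : ℝ → ℝ} (hf : ContinuousOn f (Icc 0 T))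
    (h0 : ∀ t ∈ Ioc 0 T, f t = 0) : ∀ t ∈ Icc 0 T, f t = 0 :=
  Set.EqOn.of_subset_closure (g := fun _ => 0) h0 hf continuousOn_const Ioc_subset_Icc_self
    (closure_Ioc hT.ne).ge

/-- The continuous extensions `Gt`, `Gg`, `Gh` of `∂ₜS`, `∇S`, `∇²S` to `[0,T] × closure Ω`, in
terms of which the equation and the boundary condition also hold at `t = 0`. -/
theorem IsSmoothSolution.exists_extensions {Ω : Set (EuclideanSpace ℝ (Fin n))} (hΩ : IsOpen Ω)
    {T : ℝ} (hT : 0 < T) {α β : ℝ} (hα : 0 < α) {c d : ℝ → ℝ} (hc : Continuous c)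
    (hd : ContDiff ℝ 1 d) {S : ℝ → EuclideanSpace ℝ (Fin n) → ℝ}
    (hS : IsSmoothSolution Ω T α β c d S) :
    ∃ (Gt : ℝ → EuclideanSpace ℝ (Fin n) → ℝ)
      (Gg : ℝ → EuclideanSpace ℝ (Fin n) → EuclideanSpace ℝ (Fin n))
      (Gh : ℝ → EuclideanSpace ℝ (Fin n) →
        EuclideanSpace ℝ (Fin n) →L[ℝ] EuclideanSpace ℝ (Fin n)),
      ContinuousOn (fun p : ℝ × EuclideanSpace ℝ (Fin n) => Gt p.1 p.2) (Icc 0 T ×ˢ closure Ω) ∧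
      ContinuousOn (fun p : ℝ × EuclideanSpace ℝ (Fin n) => Gg p.1 p.2) (Icc 0 T ×ˢ closure Ω) ∧
      ContinuousOn (fun p : ℝ × EuclideanSpace ℝ (Fin n) => Gh p.1 p.2) (Icc 0 T ×ˢ closure Ω) ∧
      (∀ t ∈ Icc 0 T, ∀ x ∈ Ω, Gt t x = timeDeriv T S t x) ∧
      (∀ t ∈ Icc 0 T, ∀ x ∈ Ω, Gg t x = ∇ (S t) x) ∧
      (∀ t ∈ Icc 0 T, ∀ x ∈ Ω, HasDerivWithinAt (fun s => S s x) (Gt t x) (Icc 0 T) t) ∧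
      (∀ t ∈ Icc 0 T, ∀ x ∈ Ω, HasFDerivAt (S t) (innerSL ℝ (Gg t x)) x) ∧
      (∀ t ∈ Icc 0 T, ∀ x ∈ Ω, HasFDerivAt (Gg t) (Gh t x) x) ∧
      (∀ t ∈ Icc 0 T, ∀ x ∈ Ω,
        c ‖Gg t x‖ * Gt t x = α * coordTrace (Gh t x) - β * deriv d (S t x)) ∧
      (∀ t ∈ Icc 0 T, ∀ x ν, IsOuterUnitNormal Ω x ν → ⟪Gg t x, ν⟫ = 0) := by
  obtain ⟨Gt, hGtc, hGt⟩ := hS.isC12.timeDeriv_extends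
  obtain ⟨Gg, hGgc, hGg⟩ := hS.isC12.gradient_extends
  obtain ⟨Gh, hGhc, hGh⟩ := hS.isC12.hessian_extends
  have hgrad : ∀ t ∈ Icc 0 T, ∀ x ∈ Ω, HasFDerivAt (∇ (S t)) (Gh t x) x := by
    intro t ht x hx
    have h2 := hS.isC12.contDiffOn_space t ht
    have h1 : DifferentiableAt ℝ (fderiv ℝ (S t)) x :=
      ((h2.fderiv_of_isOpen hΩ (m := 1) (by norm_num)).differentiableOn one_ne_zero).differentiableAt
        (hΩ.mem_nhds hx)
    have h3 : DifferentiableAt ℝ (∇ (S t)) x :=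
      (InnerProductSpace.toDual ℝ
        (EuclideanSpace ℝ (Fin n))).symm.toContinuousLinearEquiv.differentiableAt.comp x h1
    rw [hGh t ht x hx]
    exact h3.hasFDerivAt
  refine ⟨Gt, Gg, Gh, hGtc, hGgc, hGhc, hGt, hGg, ?_, ?_, ?_, ?_, ?_⟩
  · intro t ht x hx
    rw [hGt t ht x hx]
    exact (hS.isC12.differentiable_time x hx t ht).hasDerivWithinAt
  · intro t ht x hx
    have h1 : DifferentiableAt ℝ (S t) x :=
      ((hS.isC12.contDiffOn_space t ht).differentiableOn two_ne_zero).differentiableAt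
        (hΩ.mem_nhds hx)
    rw [hGg t ht x hx]
    exact h1.hasGradientAt.hasFDerivAt
  · intro t ht x hx
    refine (hgrad t ht x hx).congr_of_eventuallyEq ?_
    filter_upwards [hΩ.mem_nhds hx] with y hy using hGg t ht y hy
  · intro t ht x hx
    have hxc := subset_closure hx
    refine sub_eq_zero.1 (eq_zero_on_Icc_of_Ioc hT (f := fun t => c ‖Gg t x‖ * Gt t x -
      (α * coordTrace (Gh t x) - β * deriv d (S t x))) ?_ ?_ t ht)
    · have h1 := hGtc.uncurry_right' hxc
      have h2 := hc.comp_continuousOn (hGgc.uncurry_right' hxc).norm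
      have h3 := continuous_coordTrace.comp_continuousOn (hGhc.uncurry_right' hxc)
      have h4 := (hd.continuous_deriv le_rfl).comp_continuousOn
        (hS.isC12.continuousOn.uncurry_right' hxc)
      exact (h2.mul h1).sub ((continuousOn_const.mul h3).sub (continuousOn_const.mul h4))
    · intro s hs
      have hs' := Ioc_subset_Icc_self hs
      have h1 := hS.equation s hs x hx
      rw [((hgrad s hs' x hx).fun_const_smul α).divergence, coordTrace_smul, ← hGt s hs' x hx,
        show ∇ (S s) x = Gg s x from (hGg s hs' x hx).symm] at h1
      exact sub_eq_zero.2 h1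
  · intro t ht x ν hν
    have hxc : x ∈ closure Ω := frontier_subset_closure hν.1
    refine eq_zero_on_Icc_of_Ioc hT (f := fun t => ⟪Gg t x, ν⟫)
      ((hGgc.uncurry_right' hxc).inner continuousOn_const) (fun s hs => ?_) t ht
    have hs' := Ioc_subset_Icc_self hs
    have h1 := (mul_eq_zero.1 (hS.neumann s hs x ν hν)).resolve_left hα.ne'
    have h2 : extendFrom Ω (∇ (S s)) x = Gg s x := by
      refine extendFrom_eq hxc ?_
      refine (((hGgc.uncurry_left' hs') x hxc).mono subset_closure).congr' ?_
      filter_upwards [self_mem_nhdsWithin] with y hy using hGg s hs' y hy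
    rwa [boundaryDeriv, h2] at h1

end

/-! ### The energy identity -/

theorem mainTheorem6 {n : ℕ} (hn1 : 1 ≤ n) (hn3 : n ≤ 3)
    (Ω : Set (EuclideanSpace ℝ (Fin n))) (hΩ : IsBoundedLipschitzDomain Ω)
    (T : ℝ) (hT : 0 < T) (α β : ℝ) (hα : 0 < α) (hβ : 0 < β)
    (c d : ℝ → ℝ) (hc : Continuous c) (hc0 : ∀ s, 0 ≤ c s) (hd : ContDiff ℝ 1 d)
    (S : ℝ → EuclideanSpace ℝ (Fin n) → ℝ) (hS : IsSmoothSolution Ω T α β c d S) :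
    ∀ t ∈ Icc (0 : ℝ) T,
      IntegrableOn (energyDensity α β d (S t)) Ω ∧
      IntegrableOn (fun x => c ‖∇ (S t) x‖ * |timeDeriv T S t x| ^ 2) Ω ∧
      HasDerivWithinAt (fun s => energy Ω α β d (S s))
        (-∫ x in Ω, c ‖∇ (S t) x‖ * |timeDeriv T S t x| ^ 2) (Icc 0 T) t ∧
      (-∫ x in Ω, c ‖∇ (S t) x‖ * |timeDeriv T S t x| ^ 2) ≤ 0 := by
  obtain ⟨Gt, Gg, Gh, hGtc, hGgc, hGhc, hGt, hGg, hdt, hdx, hdxx, heq, hν⟩ :=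
    hS.exists_extensions hΩ.isOpen hT hα hc hd
  have hSc := hS.isC12.continuousOn
  have hmeas := hΩ.isOpen.measurableSet
  have hcpt := hΩ.isBounded.isCompact_closure
  have hcptT : IsCompact (Icc 0 T ×ˢ closure Ω) := isCompact_Icc.prod hcpt
  have hintc {f : EuclideanSpace ℝ (Fin n) → ℝ} (hf : ContinuousOn f (closure Ω)) :
      IntegrableOn f Ω := (hf.integrableOn_compact hcpt).mono_set subset_closure
  have hΛc {s} (hs : s ∈ Icc 0 T) : ContinuousOn (fun x => coordTrace (Gh s x)) (closure Ω) :=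
    continuous_coordTrace.comp_continuousOn (hGhc.uncurry_left' hs)
  have hGg2c {s} (hs : s ∈ Icc 0 T) : ContinuousOn (fun x => ‖Gg s x‖ ^ 2) (closure Ω) :=
    (hGgc.uncurry_left' hs).norm.pow 2
  have hdc {s} (hs : s ∈ Icc 0 T) : ContinuousOn (fun x => d (S s x)) (closure Ω) :=
    hd.continuous.comp_continuousOn (hSc.uncurry_left' hs)
  have hec {s} (hs : s ∈ Icc 0 T) :
      ContinuousOn (fun x => α / 2 * ‖Gg s x‖ ^ 2 + β * d (S s x)) (closure Ω) :=
    (continuousOn_const.mul (hGg2c hs)).add (continuousOn_const.mul (hdc hs))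
  have hdens {s} (hs : s ∈ Icc 0 T) : EqOn (fun x => α / 2 * ‖Gg s x‖ ^ 2 + β * d (S s x))
      (energyDensity α β d (S s)) Ω := by
    intro x hx
    simp only [energyDensity, hGg s hs x hx]
  have henergy {s} (hs : s ∈ Icc 0 T) :
      energy Ω α β d (S s) = ∫ x in Ω, (α / 2 * ‖Gg s x‖ ^ 2 + β * d (S s x)) :=
    (setIntegral_congr_fun hmeas (hdens hs)).symm
  -- Increments of the energy do not involve mixed derivatives of `S`.
  have hdiff {s t} (hs : s ∈ Icc 0 T) (ht : t ∈ Icc 0 T) :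
      energy Ω α β d (S s) - energy Ω α β d (S t) =
        ∫ x in Ω, (-(α / 2) * (coordTrace (Gh s x) + coordTrace (Gh t x)) * (S s x - S t x) +
          β * (d (S s x) - d (S t x))) := by
    have hgreen := hΩ.integral_green (v := fun x => S s x - S t x) (V := fun x => Gg s x - Gg t x)
      (W := fun x => Gg s x + Gg t x) (H := fun x => Gh s x + Gh t x)
      ((hSc.uncurry_left' hs).sub (hSc.uncurry_left' ht))
      ((hGgc.uncurry_left' hs).sub (hGgc.uncurry_left' ht))
      ((hGgc.uncurry_left' hs).add (hGgc.uncurry_left' ht))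
      ((hGhc.uncurry_left' hs).add (hGhc.uncurry_left' ht))
      (fun x hx => by
        rw [map_sub]
        exact (hdx s hs x hx).sub (hdx t ht x hx))
      (fun x hx => (hdxx s hs x hx).add (hdxx t ht x hx))
      (fun x ν hx => by rw [inner_add_left, hν s hs x ν hx, hν t ht x ν hx, add_zero])
    have hgint : IntegrableOn (fun x => (S s x - S t x) * coordTrace (Gh s x + Gh t x) +
        ⟪Gg s x - Gg t x, Gg s x + Gg t x⟫) Ω := by
      refine hintc ((((hSc.uncurry_left' hs).sub (hSc.uncurry_left' ht)).mul ?_).add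
        (((hGgc.uncurry_left' hs).sub (hGgc.uncurry_left' ht)).inner
          ((hGgc.uncurry_left' hs).add (hGgc.uncurry_left' ht))))
      exact continuous_coordTrace.comp_continuousOn
        ((hGhc.uncurry_left' hs).add (hGhc.uncurry_left' ht))
    have heint : IntegrableOn (fun x => α / 2 * ‖Gg s x‖ ^ 2 + β * d (S s x) -
        (α / 2 * ‖Gg t x‖ ^ 2 + β * d (S t x))) Ω := (hintc (hec hs)).sub (hintc (hec ht))
    -- Subtracts `α / 2` times the vanishing Green integral, after which the two integrands agree
    -- pointwise.
    rw [henergy hs, henergy ht, ← integral_sub (hintc (hec hs)) (hintc (hec ht)),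
      ← sub_zero (∫ x in Ω, _), ← mul_zero (α / 2), ← hgreen, ← integral_const_mul,
      ← integral_sub heint (hgint.const_mul _)]
    refine setIntegral_congr_fun hmeas fun x _ => ?_
    have h1 : ⟪Gg s x - Gg t x, Gg s x + Gg t x⟫ = ‖Gg s x‖ ^ 2 - ‖Gg t x‖ ^ 2 := by
      rw [inner_sub_left, inner_add_right, inner_add_right, real_inner_self_eq_norm_sq,
        real_inner_self_eq_norm_sq, real_inner_comm (Gg s x) (Gg t x)]
      ring
    simp only [h1, coordTrace_add]
    ring
  obtain ⟨Bt, hBt⟩ := hcptT.exists_bound_of_continuousOn hGtc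
  obtain ⟨BS, hBS⟩ := hcptT.exists_bound_of_continuousOn hSc
  obtain ⟨BΛ, hBΛ⟩ := hcptT.exists_bound_of_continuousOn
    (continuous_coordTrace.comp_continuousOn hGhc)
  -- `d'` need only be bounded on the range of `S`, which lies in `[-BS, BS]`.
  obtain ⟨D, hD⟩ := (isCompact_Icc (a := -BS) (b := BS)).exists_bound_of_continuousOn
    (hd.continuous_deriv le_rfl).continuousOn
  have hSlip {s t} (hs : s ∈ Icc 0 T) (ht : t ∈ Icc 0 T) {x} (hx : x ∈ Ω) :
      |S s x - S t x| ≤ Bt * |s - t| :=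
    (convex_Icc 0 T).norm_image_sub_le_of_norm_hasDerivWithin_le (f := fun s => S s x)
      (fun s hs => hdt s hs x hx) (fun s hs => hBt (s, x) ⟨hs, subset_closure hx⟩) ht hs
  have hdlip {s t} (hs : s ∈ Icc 0 T) (ht : t ∈ Icc 0 T) {x} (hx : x ∈ Ω) :
      |d (S s x) - d (S t x)| ≤ D * |S s x - S t x| :=
    (convex_Icc (-BS) BS).norm_image_sub_le_of_norm_deriv_le
      (fun y _ => hd.differentiable one_ne_zero y) hD
      (abs_le.1 (hBS (t, x) ⟨ht, subset_closure hx⟩))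
      (abs_le.1 (hBS (s, x) ⟨hs, subset_closure hx⟩))
  intro t ht
  have hdiss : EqOn (fun x => c ‖Gg t x‖ * |Gt t x| ^ 2)
      (fun x => c ‖∇ (S t) x‖ * |timeDeriv T S t x| ^ 2) Ω := by
    intro x hx
    simp only [hGg t ht x hx, hGt t ht x hx]
  have hdissc : ContinuousOn (fun x => c ‖Gg t x‖ * |Gt t x| ^ 2) (closure Ω) :=
    (hc.comp_continuousOn (hGgc.uncurry_left' ht).norm).mul ((hGtc.uncurry_left' ht).abs.pow 2)
  refine ⟨(hintc (hec ht)).congr_fun (hdens ht) hmeas, (hintc hdissc).congr_fun hdiss hmeas, ?_,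
    neg_nonpos.2 (integral_nonneg fun x => mul_nonneg (hc0 _) (by positivity))⟩
  rw [← setIntegral_congr_fun hmeas hdiss, ← integral_neg, hasDerivWithinAt_iff_tendsto_slope]
  set q : ℝ → EuclideanSpace ℝ (Fin n) → ℝ := fun s x =>
    -(α / 2) * (coordTrace (Gh s x) + coordTrace (Gh t x)) * slope (fun s => S s x) t s +
      β * slope (fun s => d (S s x)) t s with hq
  have hslope : ∀ᶠ s in 𝓝[Icc 0 T \ {t}] t,
      ∫ x in Ω, q s x = slope (fun s => energy Ω α β d (S s)) t s := by
    filter_upwards [self_mem_nhdsWithin] with s hs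
    rw [slope_def_field, hdiff hs.1 ht, ← integral_div]
    refine setIntegral_congr_fun hmeas fun x _ => ?_
    simp only [hq, slope_def_field]
    ring
  refine Tendsto.congr' hslope ?_
  refine tendsto_integral_filter_of_dominated_convergence
    (fun _ => α / 2 * (BΛ + BΛ) * Bt + β * (D * Bt)) ?_ ?_ ?_ ?_
  · filter_upwards [self_mem_nhdsWithin] with s hs
    simp only [hq, slope_def_field]
    have h1 := (continuousOn_const (c := -(α / 2))).mul ((hΛc hs.1).add (hΛc ht))
    have h2 := ((hSc.uncurry_left' hs.1).sub (hSc.uncurry_left' ht)).div_const (s - t)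
    have h3 := (continuousOn_const (c := β)).mul (((hdc hs.1).sub (hdc ht)).div_const (s - t))
    exact (hintc ((h1.mul h2).add h3)).aestronglyMeasurable
  · filter_upwards [self_mem_nhdsWithin] with s hs
    filter_upwards [ae_restrict_mem hmeas] with x hx
    have hst : 0 < |s - t| := abs_pos.2 (sub_ne_zero.2 hs.2)
    -- The sign of `D` comes from an actual value of `S`, so it is available only once a point of
    -- `Ω` is given.
    have hD0 : 0 ≤ D := (norm_nonneg _).trans
      (hD (S t x) (abs_le.1 (hBS (t, x) ⟨ht, subset_closure hx⟩)))
    have h1 : |slope (fun s => S s x) t s| ≤ Bt := by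
      rw [slope_def_field, abs_div, div_le_iff₀ hst]
      exact hSlip hs.1 ht hx
    have h2 : |slope (fun s => d (S s x)) t s| ≤ D * Bt := by
      rw [slope_def_field, abs_div, div_le_iff₀ hst, mul_assoc]
      exact (hdlip hs.1 ht hx).trans (mul_le_mul_of_nonneg_left (hSlip hs.1 ht hx) hD0)
    have h3 : |coordTrace (Gh s x)| ≤ BΛ := hBΛ (s, x) ⟨hs.1, subset_closure hx⟩
    have h4 : |coordTrace (Gh t x)| ≤ BΛ := hBΛ (t, x) ⟨ht, subset_closure hx⟩
    rw [hq, Real.norm_eq_abs]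
    refine (abs_add_le _ _).trans ?_
    rw [abs_mul, abs_mul, abs_mul, abs_neg, abs_of_pos (half_pos hα), abs_of_pos hβ]
    have h5 := (abs_add_le (coordTrace (Gh s x)) (coordTrace (Gh t x))).trans (add_le_add h3 h4)
    have h6 := (abs_nonneg _).trans h5
    gcongr
  · exact integrableOn_const (hΩ.isBounded.measure_lt_top.ne)
  · filter_upwards [ae_restrict_mem hmeas] with x hx
    have hxc := subset_closure hx
    have h1 : Tendsto (fun s => slope (fun s => S s x) t s) (𝓝[Icc 0 T \ {t}] t) (𝓝 (Gt t x)) :=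
      hasDerivWithinAt_iff_tendsto_slope.1 (hdt t ht x hx)
    have h2 : Tendsto (fun s => slope (fun s => d (S s x)) t s) (𝓝[Icc 0 T \ {t}] t)
        (𝓝 (deriv d (S t x) * Gt t x)) :=
      hasDerivWithinAt_iff_tendsto_slope.1
        (((hd.differentiable one_ne_zero (S t x)).hasDerivAt).comp_hasDerivWithinAt t (hdt t ht x hx))
    have h3 : Tendsto (fun s => coordTrace (Gh s x)) (𝓝[Icc 0 T \ {t}] t)
        (𝓝 (coordTrace (Gh t x))) :=
      ((continuous_coordTrace.comp_continuousOn (hGhc.uncurry_right' hxc)) t ht).mono_left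
        (nhdsWithin_mono _ sdiff_subset)
    have h4 := (((h3.add_const (coordTrace (Gh t x))).const_mul (-(α / 2))).mul h1).add
      (h2.const_mul β)
    -- The equation multiplied by `-∂ₜS`. The two equal traces in the limit cancel the factor `1 /
    -- 2`.
    have h5 : -(c ‖Gg t x‖ * |Gt t x| ^ 2) = -(α / 2) * (coordTrace (Gh t x) + coordTrace (Gh t x))
        * Gt t x + β * (deriv d (S t x) * Gt t x) := by
      rw [sq_abs]
      linear_combination (-Gt t x) * heq t ht x hx
    rw [h5]
    exact h4
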